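/- **Theorem (Joint Cumulative Distribution Function).** *Setting.* Let $\mathcal E$, $\mathcal S$ be finite sets, $\alpha$ a probability vector on $\mathcal E$, $T$ an $\mathcal E\times\mathcal E$ subintensity matrix, $U$ an entrywise nonnegative $\mathcal E\times\mathcal S$ matrix with $T\mathbf 1+U\mathbf 1=\mathbf 0$, $Q_1,Q_2$ two $\mathcal S\times\mathcal S$ subintensity matrices, and $a_1,a_2>0$. (A subintensity matrix has nonpositive diagonal entries, nonnegative off-diagonal entries and nonpositive row sums.) Let $J_{1,2}$ be a right-continuous continuous-time Markov chain on $\mathcal E\cup\mathcal S$ with initial distribution $(\alpha,\mathbf 0)$ and intensity matrix $\begin{pmatrix}T&U\\ \mathbf 0&\mathbf 0\end{pmatrix}$, let $\tau_{1,2}=\inf\{t\ge 0: J_{1,2}(t)\notin\mathcal E\}\in[0,\infty]$ and, if $\tau_{1,2}<\infty$, let $K=J_{1,2}(\tau_{1,2})\in\mathcal S$. Up to time $\tau_{1,2}$ the processes $J_1$ and $J_2$ coincide with $J_{1,2}$. After $\tau_{1,2}$, given $K=k$, they evolve independently of each other and of $J_{1,2}$, as right-continuous Markov chains on $\mathcal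 S$ started from $k$ and governed by $Q_1$ and $Q_2$ respectively, until absorption in a cemetery state (entered at rates $-Q_i\mathbf 1$). Let $\tilde\tau_i\in[0,\infty]$ be the time that $J_i$ spends in $\mathcal S$. A random vector $(X_1,X_2)$ with values in $[0,\infty]^2$ is *CSPH distributed* with parameters $(\alpha,T,U,Q_1,Q_2,a_1,a_2)$ if it has the law of $(a_1\tau_{1,2}+\tilde\tau_1,\ a_2\tau_{1,2}+\tilde\tau_2)$ for such processes. *Notation.* $\otimes$ is the Kronecker product, and $A\oplus B=A\otimes I+I\otimes B$ is the Kronecker sum. Put $z_1\curlywedge z_2=\min(z_1/a_1,z_2/a_2)$, $P=\sum_{k\in\mathcal S}Ue_k\,(e_k^\top\otimes e_k^\top)$ and $$V[A,B,C,u]=\begin{pmatrix}I&\mathbf 0\end{pmatrix}\exp\left(\begin{pmatrix}A&B\\ \mathbf 0&C\end{pmatrix}u\right)\begin{pmatrix}\mathbf 0\\ I\end{pmatrix},\qquad u\ge 0 .$$ *Claim.* Let $(X_1,X_2)$ be CSPH distributed with parameters $(\alpha,T,U,Q_1,Q_2,a_1,a_2)$. For $z_1,z_2\ge 0$ and $i=1,2$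 put $S_i=e^{Q_i(z_i-a_i(z_1\curlywedge z_2))}\mathbf 1$. Then, with $\mathbf 0$ in the Kronecker sums being the $\mathcal S\times\mathcal S$ zero matrix, $$\begin{aligned}\mathbb P(X_1\le z_1,\,X_2\le z_2)={}&\alpha V[T,P,\mathbf 0\oplus\mathbf 0,z_1\curlywedge z_2](\mathbf 1\otimes\mathbf 1)\\&-\alpha V[T,P,(a_1Q_1)\oplus\mathbf 0,z_1\curlywedge z_2](S_1\otimes\mathbf 1)\\&-\alpha V[T,P,\mathbf 0\oplus(a_2Q_2),z_1\curlywedge z_2](\mathbf 1\otimes S_2)\\&+\alpha V[T,P,(a_1Q_1)\oplus(a_2Q_2),z_1\curlywedge z_2](S_1\otimes S_2).\end{aligned}$$ -/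

import Mathlib

open MeasureTheory ProbabilityTheory Filter Topology
open scoped NNReal ENNReal Matrix Kronecker

universe v₁ v₂ v₃ v₄

noncomputable section

namespace CSPH

/-! ### Matrix notions -/

/-- The Kronecker sum `A ⊕ B = A ⊗ I + I ⊗ B` of two square matrices. -/
def kronSum {m n : Type*} [DecidableEq m] [DecidableEq n]
    (A : Matrix m m ℝ) (B : Matrix n n ℝ) : Matrix (m × n) (m × n) ℝ :=
  A ⊗ₖ (1 : Matrix n n ℝ) + (1 : Matrix m m ℝ) ⊗ₖ B

/-- The Kronecker product `v ⊗ w` of two vectors. -/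
def kronVec {m n : Type*} (v : m → ℝ) (w : n → ℝ) : m × n → ℝ :=
  fun p => v p.1 * w p.2

/-- Van Loan's matrix function
`V[A, B, C, u] = (I 0) exp(((A, B), (0, C)) u) (0 ; I)`. -/
def vanLoan {m n : Type*} [Fintype m] [Fintype n] [DecidableEq m] [DecidableEq n]
    (A : Matrix m m ℝ) (B : Matrix m n ℝ) (C : Matrix n n ℝ) (u : ℝ) : Matrix m n ℝ :=
  Matrix.fromCols (1 : Matrix m m ℝ) (0 : Matrix m n ℝ) *
    NormedSpace.exp (u • Matrix.fromBlocks A B 0 C) *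
      Matrix.fromRows (0 : Matrix m n ℝ) (1 : Matrix n n ℝ)

/-- `P = ∑ₖ u⁽ᵏ⁾ (eₖᵀ ⊗ eₖᵀ)`, where `u⁽ᵏ⁾ = U eₖ` is the `k`-th column of `U`. -/
def shockMatrix {E S : Type*} [Fintype S] [DecidableEq S] (U : Matrix E S ℝ) :
    Matrix E (S × S) ℝ :=
  ∑ k : S, Matrix.vecMulVec (U *ᵥ Pi.single k 1)
    (kronVec (Pi.single k (1 : ℝ)) (Pi.single k (1 : ℝ)))

/-- `z₁ ⋏ z₂ = min (z₁ / a₁) (z₂ / a₂)`. -/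
def scaledMin (a₁ a₂ z₁ z₂ : ℝ) : ℝ := min (z₁ / a₁) (z₂ / a₂)

/-- The vector `exp (Q (z - a u)) 𝟏`; with `Q = Qᵢ`, `a = aᵢ`, `z = zᵢ` and `u = z₁ ⋏ z₂` this is
`Sᵢ(z₁, z₂)`. -/
def survivalVec {S : Type*} [Fintype S] [DecidableEq S]
    (Q : Matrix S S ℝ) (a z u : ℝ) : S → ℝ :=
  NormedSpace.exp ((z - a * u) • Q) *ᵥ 1

/-! ### Continuous-time Markov chains on a finite state space -/

/-- A subintensity matrix: nonpositive diagonal, nonnegative off-diagonal entries, nonpositive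
row sums. -/
structure IsSubintensity {I : Type*} [Fintype I] (Q : Matrix I I ℝ) : Prop where
  diag_nonpos : ∀ i, Q i i ≤ 0
  offDiag_nonneg : ∀ i j, i ≠ j → 0 ≤ Q i j
  rowSum_nonpos : ∀ i, ∑ j, Q i j ≤ 0

/-- The intensity matrix on `I ∪ {∂}` obtained from a subintensity matrix `Q` on `I` by adding an
absorbing state `∂ = none`, entered from `i` at the rate `-(Q 𝟏) i`. -/
def absorbing {I : Type*} [Fintype I] (Q : Matrix I I ℝ) : Matrix (Option I) (Option I) ℝ
  | some i, some j => Q i j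
  | some i, none => -∑ j, Q i j
  | none, _ => 0

/-- `J` is, under the probability measure `P`, a time-homogeneous continuous-time Markov chain on
the finite set `I` (with the discrete σ-algebra and topology) with initial distribution `ν` and
intensity matrix `G`: a process with right-continuous paths and finite-dimensional distributions
`P(J 0 = i₀, J t₁ = i₁, …, J tₙ = iₙ) = ν i₀ ∏ₘ (exp ((tₘ₊₁ - tₘ) G)) iₘ iₘ₊₁`. -/
structure IsMarkovChain {I Ω : Type*} [Fintype I] [DecidableEq I] [MeasurableSpace Ω]
    (P : Measure Ω) (J : ℝ≥0 → Ω → I) (ν : I → ℝ) (G : Matrix I I ℝ) : Prop where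
  measurableSet_eq : ∀ t i, MeasurableSet {ω | J t ω = i}
  rightCts : ∀ ω t, ∀ᶠ s in 𝓝[≥] t, J s ω = J t ω
  fdd : ∀ (n : ℕ) (t : Fin (n + 1) → ℝ≥0) (i : Fin (n + 1) → I), t 0 = 0 → Monotone t →
    P.real {ω | ∀ m, J (t m) ω = i m} =
      ν (i 0) * ∏ m : Fin n,
        NormedSpace.exp (((t m.succ : ℝ) - (t m.castSucc : ℝ)) • G) (i m.castSucc) (i m.succ)

/-- The σ-algebra on `Ω` generated by a process with values in a discrete space. -/
abbrev pathSigma {I Ω : Type*} (J : ℝ≥0 → Ω → I) : MeasurableSpace Ω :=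
  ⨆ t, MeasurableSpace.comap (J t) ⊤

/-! ### The common-shock construction -/

section Construction

variable {E S Ω : Type*}

/-- The common-shock time `τ₁₂ = inf {t ≥ 0 : J₁₂ t ∉ E}`, which is `∞` if there is no exit. -/
def shockTime (J₁₂ : ℝ≥0 → Ω → E ⊕ S) (ω : Ω) : ℝ≥0∞ :=
  ⨅ (t : ℝ≥0) (_ : ∀ e : E, J₁₂ t ω ≠ Sum.inl e), (t : ℝ≥0∞)

/-- The event that the shock occurs and the state entered at the shock is `k`, that is,
`K = J₁₂(τ₁₂) = k`. -/
def shockEvent (J₁₂ : ℝ≥0 → Ω → E ⊕ S) (k : S) : Set Ω :=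
  {ω | shockTime J₁₂ ω ≠ ∞ ∧ J₁₂ (shockTime J₁₂ ω).toNNReal ω = Sum.inr k}

open Classical in
/-- The process `Jᵢ` on `E ∪ S ∪ {∂}`: it equals `J₁₂` up to and including the shock time, and
from then on follows the post-shock process `Y` on `S ∪ {∂}`, restarted at the shock. -/
def splice (J₁₂ : ℝ≥0 → Ω → E ⊕ S) (Y : ℝ≥0 → Ω → Option S) (t : ℝ≥0) (ω : Ω) :
    Option (E ⊕ S) :=
  if (t : ℝ≥0∞) ≤ shockTime J₁₂ ω then some (J₁₂ t ω)
  else (Y (t - (shockTime J₁₂ ω).toNNReal) ω).map Sum.inr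

/-- The total time that a process on `E ∪ S ∪ {∂}` spends in `S`. -/
def timeInS (J : ℝ≥0 → Ω → Option (E ⊕ S)) (ω : Ω) : ℝ≥0∞ :=
  volume {t : ℝ | 0 ≤ t ∧ ∃ k : S, J t.toNNReal ω = some (Sum.inr k)}

/-- The variable `Xᵢ = aᵢ τ₁₂ + τ̃ᵢ`, where `τ̃ᵢ` is the time that `Jᵢ` spends in `S`. -/
def scaledLifetime (J₁₂ : ℝ≥0 → Ω → E ⊕ S) (Y : ℝ≥0 → Ω → Option S) (a : ℝ) (ω : Ω) : ℝ≥0∞ :=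
  ENNReal.ofReal a * shockTime J₁₂ ω + timeInS (splice J₁₂ Y) ω

end Construction

section Model

variable {E S : Type*} [Fintype E] [Fintype S] [DecidableEq E] [DecidableEq S]

/-- Admissible parameters `(α, T, U, Q₁, Q₂, a₁, a₂)`. -/
structure IsParam (α : E → ℝ) (T : Matrix E E ℝ) (U : Matrix E S ℝ) (Q₁ Q₂ : Matrix S S ℝ)
    (a₁ a₂ : ℝ) : Prop where
  initial_nonneg : ∀ e, 0 ≤ α e
  initial_sum : ∑ e, α e = 1
  sub_T : IsSubintensity T
  U_nonneg : ∀ e k, 0 ≤ U e k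
  rowSum : T *ᵥ 1 + U *ᵥ 1 = 0
  sub_Q₁ : IsSubintensity Q₁
  sub_Q₂ : IsSubintensity Q₂
  a₁_pos : 0 < a₁
  a₂_pos : 0 < a₂

/-- The processes underlying the model. The joint process `J₁₂` is a Markov chain on `E ∪ S` with
initial distribution `(α, 0)` and intensity matrix `((T, U), (0, 0))`. Given that the shock leads
to the state `K = k`, the post-shock processes `Y₁` and `Y₂` are Markov chains on `S` started from
`k` and governed by `Q₁` and `Q₂` until absorption, and they evolve independently of each other
and of `J₁₂`. -/
structure IsCommonShock {Ω : Type*} [MeasurableSpace Ω] (P : Measure Ω)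
    (J₁₂ : ℝ≥0 → Ω → E ⊕ S) (Y₁ Y₂ : ℝ≥0 → Ω → Option S)
    (α : E → ℝ) (T : Matrix E E ℝ) (U : Matrix E S ℝ) (Q₁ Q₂ : Matrix S S ℝ) : Prop where
  joint : IsMarkovChain P J₁₂ (Sum.elim α 0) (Matrix.fromBlocks T U 0 0)
  post₁ : ∀ k : S, P (shockEvent J₁₂ k) ≠ 0 →
    IsMarkovChain P[|shockEvent J₁₂ k] Y₁ (Pi.single (some k) 1) (absorbing Q₁)
  post₂ : ∀ k : S, P (shockEvent J₁₂ k) ≠ 0 →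
    IsMarkovChain P[|shockEvent J₁₂ k] Y₂ (Pi.single (some k) 1) (absorbing Q₂)
  indep : ∀ k : S, P (shockEvent J₁₂ k) ≠ 0 →
    iIndep ![pathSigma J₁₂, pathSigma Y₁, pathSigma Y₂] P[|shockEvent J₁₂ k]

/-- The random vector `(X₁, X₂)` follows the bivariate common-shock phase-type distribution with
parameters `(α, T, U, Q₁, Q₂, a₁, a₂)`: it has the law of `(a₁ τ₁₂ + τ̃₁, a₂ τ₁₂ + τ̃₂)` for some
underlying processes. The values lie in `[0, ∞]`, since the parameters may be such that the shock
or an absorption does not occur. -/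
def IsCSPH {E : Type v₁} {S : Type v₂} [Fintype E] [Fintype S] [DecidableEq E]
    [DecidableEq S] {Ω : Type v₃} [MeasurableSpace Ω] (μ : Measure Ω) (X₁ X₂ : Ω → ℝ≥0∞)
    (α : E → ℝ) (T : Matrix E E ℝ) (U : Matrix E S ℝ) (Q₁ Q₂ : Matrix S S ℝ) (a₁ a₂ : ℝ) : Prop :=
  IsParam α T U Q₁ Q₂ a₁ a₂ ∧
  ∃ (Ω' : Type v₄) (_ : MeasurableSpace Ω') (P : Measure Ω') (_ : IsProbabilityMeasure P)
    (J₁₂ : ℝ≥0 → Ω' → E ⊕ S) (Y₁ Y₂ : ℝ≥0 → Ω' → Option S),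
    IsCommonShock P J₁₂ Y₁ Y₂ α T U Q₁ Q₂ ∧
    IdentDistrib (fun ω => (X₁ ω, X₂ ω))
      (fun ω => (scaledLifetime J₁₂ Y₁ a₁ ω, scaledLifetime J₁₂ Y₂ a₂ ω)) μ P

end Model

end CSPH

end

open CSPH

/-! Conditionally on the shock time τ and the state K entered there, X₁ and X₂ are independent. On
{K = k}, τ has density f_k(t) = α e^{tT} U e_k: the states of S are absorbing for J₁₂, so {τ ≤ t, K
= k} is almost surely {J₁₂(t) = k}, whose probability is read off the semigroup
(`measureReal_shockTime_le`, `map_shockTime_restrict`). Given τ = t and K = k, the event Xᵢ ≤ zᵢ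
says that aᵢ t ≤ zᵢ and that the post-shock chain is absorbed by time zᵢ - aᵢ t, which has
probability 1 - (e^{Qᵢ(zᵢ - aᵢ t)} 𝟏)_k. The two constraints aᵢ t ≤ zᵢ amount to t ≤ u = z₁ ⋏ z₂.
Hence the distribution function is the sum over k of ∫₀ᵘ f_k(t) ∏ᵢ (1 - (e^{Qᵢ(zᵢ - aᵢ t)} 𝟏)_k) dt
(`IsCommonShock.measureReal_scaledLifetime_le`).

Expanding the product gives four integrals. Since e^{Qᵢ(zᵢ - aᵢ t)} 𝟏 = e^{(u - t) aᵢ Qᵢ} Sᵢ and the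
exponential of a Kronecker sum acts factorwise, each integrand is α e^{tT} P e^{(u - t)(C₁ ⊕ C₂)}
(v₁ ⊗ v₂), where P selects the diagonal entries (k, k) because both chains start from the same
state. A factor 1 is the case Cᵢ = 0, vᵢ = 𝟏. Van Loan's formula (`dotProduct_vanLoan_mulVec`) turns
the integrals into the stated terms. -/

namespace CSPH

/-! ### Matrix exponentials: intertwining and Duhamel interpolation -/

section MatrixExponential

open scoped Matrix.Norms.Operator

/-- Matrices intertwined by `R` have exponentials intertwined by `R`. -/
theorem exp_mul_eq_mul_exp {m n : Type*} [Fintype m] [Fintype n] [DecidableEq m] [DecidableEq n]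
    {A : Matrix m m ℝ} {B : Matrix n n ℝ} {R : Matrix m n ℝ} (h : A * R = R * B) :
    NormedSpace.exp A * R = R * NormedSpace.exp B := by
  have hpow : ∀ k : ℕ, A ^ k * R = R * B ^ k := by
    intro k
    induction k with
    | zero => simp
    | succ k ih =>
      rw [pow_succ, pow_succ, Matrix.mul_assoc, h, ← Matrix.mul_assoc, ih, Matrix.mul_assoc]
  have h1 := (NormedSpace.exp_series_hasSum_exp' (𝕂 := ℝ) A).map
    (AddMonoidHom.mk' (fun M : Matrix m m ℝ => M * R) fun M N => Matrix.add_mul M N R) (by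
      change Continuous fun M : Matrix m m ℝ => M * R
      fun_prop)
  have h2 := (NormedSpace.exp_series_hasSum_exp' (𝕂 := ℝ) B).map
    (AddMonoidHom.mk' (fun M : Matrix n n ℝ => R * M) fun M N => Matrix.mul_add R M N) (by
      change Continuous fun M : Matrix n n ℝ => R * M
      fun_prop)
  refine h1.unique ?_
  convert h2 using 1
  · ext1 k
    simp [hpow]
  · rfl

theorem exp_smul_mul_eq_mul_exp_smul {m n : Type*} [Fintype m] [Fintype n] [DecidableEq m]
    [DecidableEq n] {A : Matrix m m ℝ} {B : Matrix n n ℝ} {R : Matrix m n ℝ} (h : A * R = R * B)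
    (t : ℝ) : NormedSpace.exp (t • A) * R = R * NormedSpace.exp (t • B) :=
  exp_mul_eq_mul_exp (by rw [Matrix.smul_mul, Matrix.mul_smul, h])

/-- The path interpolates between e^{uN} and e^{uM}. Integrating its derivative gives the
perturbation formula behind Van Loan's identity. -/
theorem hasDerivAt_duhamel {m : Type*} [Fintype m] [DecidableEq m] (M N : Matrix m m ℝ) (u t : ℝ) :
    HasDerivAt (fun t : ℝ => NormedSpace.exp (t • M) * NormedSpace.exp ((u - t) • N))
      (NormedSpace.exp (t • M) * (M - N) * NormedSpace.exp ((u - t) • N)) t := by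
  have h1 := hasDerivAt_exp_smul_const M t
  have h2 := (hasDerivAt_exp_smul_const' N (u - t)).scomp t ((hasDerivAt_id t).const_sub u)
  refine (h1.mul h2).congr_deriv ?_
  rw [neg_one_smul]
  simp only [Function.comp_apply]
  noncomm_ring

theorem continuous_exp_smul {m : Type*} [Fintype m] [DecidableEq m] (M : Matrix m m ℝ) :
    Continuous fun t : ℝ => NormedSpace.exp (t • M) :=
  continuous_iff_continuousAt.2 fun t => (hasDerivAt_exp_smul_const M t).continuousAt

theorem hasDerivAt_linear_duhamel {m : Type*} [Fintype m] [DecidableEq m] (M N : Matrix m m ℝ)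
    (u t : ℝ) (L : Matrix m m ℝ →ₗ[ℝ] ℝ) :
    HasDerivAt (fun t : ℝ => L (NormedSpace.exp (t • M) * NormedSpace.exp ((u - t) • N)))
      (L (NormedSpace.exp (t • M) * (M - N) * NormedSpace.exp ((u - t) • N))) t :=
  (LinearMap.toContinuousLinearMap L).hasFDerivAt.comp_hasDerivAt t (hasDerivAt_duhamel M N u t)

end MatrixExponential

/-! ### Van Loan's integral formula and Kronecker sums -/

section VanLoan

variable {m n : Type*} [Fintype m] [Fintype n] [DecidableEq m] [DecidableEq n]

theorem continuous_vanLoan_integrand (A : Matrix m m ℝ) (B : Matrix m n ℝ) (C : Matrix n n ℝ)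
    (u : ℝ) (α : m → ℝ) (w : n → ℝ) :
    Continuous fun t : ℝ => α ⬝ᵥ (NormedSpace.exp (t • A) *ᵥ
      (B *ᵥ (NormedSpace.exp ((u - t) • C) *ᵥ w))) := by
  have h1 := continuous_exp_smul A
  have h2 : Continuous fun t : ℝ => NormedSpace.exp ((u - t) • C) :=
    (continuous_exp_smul C).comp (continuous_const.sub continuous_id)
  exact continuous_const.dotProduct (h1.matrix_mulVec
    (continuous_const.matrix_mulVec (h2.matrix_mulVec continuous_const)))

/-- The difference of the two block matrices is the corner B, which factors through the block
inclusion and projection. These intertwine the block-triangular exponentials with e^{tA} and e^{sC}.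
-/
theorem fromCols_mul_exp_mul_fromRows (A : Matrix m m ℝ) (B : Matrix m n ℝ) (C : Matrix n n ℝ)
    (s t : ℝ) :
    Matrix.fromCols (1 : Matrix m m ℝ) (0 : Matrix m n ℝ) *
      (NormedSpace.exp (t • Matrix.fromBlocks A B 0 C) *
        (Matrix.fromBlocks A B 0 C - Matrix.fromBlocks A 0 0 C) *
        NormedSpace.exp (s • Matrix.fromBlocks A 0 0 C)) *
      Matrix.fromRows (0 : Matrix m n ℝ) (1 : Matrix n n ℝ) =
    NormedSpace.exp (t • A) * B * NormedSpace.exp (s • C) := by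
  have hB : Matrix.fromBlocks A B 0 C - Matrix.fromBlocks A 0 0 C =
      Matrix.fromRows (1 : Matrix m m ℝ) (0 : Matrix n m ℝ) * B *
        Matrix.fromCols (0 : Matrix n m ℝ) (1 : Matrix n n ℝ) := by
    rw [Matrix.fromRows_mul, Matrix.fromRows_mul_fromCols, sub_eq_add_neg, Matrix.fromBlocks_neg,
      Matrix.fromBlocks_add]
    simp
  have h1 : NormedSpace.exp (t • Matrix.fromBlocks A B 0 C) *
      Matrix.fromRows (1 : Matrix m m ℝ) (0 : Matrix n m ℝ) =
      Matrix.fromRows (1 : Matrix m m ℝ) (0 : Matrix n m ℝ) * NormedSpace.exp (t • A) := by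
    apply exp_smul_mul_eq_mul_exp_smul
    simp [Matrix.fromBlocks_mul_fromRows, Matrix.fromRows_mul]
  have h2 : NormedSpace.exp (s • Matrix.fromBlocks A 0 0 C) *
      Matrix.fromRows (0 : Matrix m n ℝ) (1 : Matrix n n ℝ) =
      Matrix.fromRows (0 : Matrix m n ℝ) (1 : Matrix n n ℝ) * NormedSpace.exp (s • C) := by
    apply exp_smul_mul_eq_mul_exp_smul
    simp [Matrix.fromBlocks_mul_fromRows, Matrix.fromRows_mul]
  have h3 : Matrix.fromCols (1 : Matrix m m ℝ) (0 : Matrix m n ℝ) *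
      Matrix.fromRows (1 : Matrix m m ℝ) (0 : Matrix n m ℝ) = 1 := by
    simp [Matrix.fromCols_mul_fromRows]
  have h4 : Matrix.fromCols (0 : Matrix n m ℝ) (1 : Matrix n n ℝ) *
      Matrix.fromRows (0 : Matrix m n ℝ) (1 : Matrix n n ℝ) = 1 := by
    simp [Matrix.fromCols_mul_fromRows]
  calc _ = Matrix.fromCols (1 : Matrix m m ℝ) (0 : Matrix m n ℝ) *
        (NormedSpace.exp (t • Matrix.fromBlocks A B 0 C) *
          Matrix.fromRows (1 : Matrix m m ℝ) (0 : Matrix n m ℝ)) * B *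
        (Matrix.fromCols (0 : Matrix n m ℝ) (1 : Matrix n n ℝ) *
          (NormedSpace.exp (s • Matrix.fromBlocks A 0 0 C) *
            Matrix.fromRows (0 : Matrix m n ℝ) (1 : Matrix n n ℝ))) := by
        rw [hB]; simp only [Matrix.mul_assoc]
    _ = (Matrix.fromCols (1 : Matrix m m ℝ) (0 : Matrix m n ℝ) *
          Matrix.fromRows (1 : Matrix m m ℝ) (0 : Matrix n m ℝ)) * NormedSpace.exp (t • A) * B *
        ((Matrix.fromCols (0 : Matrix n m ℝ) (1 : Matrix n n ℝ) *
          Matrix.fromRows (0 : Matrix m n ℝ) (1 : Matrix n n ℝ)) * NormedSpace.exp (s • C)) := by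
        rw [h1, h2]; simp only [Matrix.mul_assoc]
    _ = _ := by rw [h3, h4, Matrix.one_mul, Matrix.one_mul]

/-- Van Loan's formula `V[A, B, C, u] = ∫₀ᵘ exp (t A) B exp ((u - t) C) dt`, in weak form. -/
theorem dotProduct_vanLoan_mulVec (A : Matrix m m ℝ) (B : Matrix m n ℝ) (C : Matrix n n ℝ)
    (u : ℝ) (α : m → ℝ) (w : n → ℝ) :
    α ⬝ᵥ (vanLoan A B C u *ᵥ w) = ∫ t in (0 : ℝ)..u, α ⬝ᵥ (NormedSpace.exp (t • A) *ᵥ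
      (B *ᵥ (NormedSpace.exp ((u - t) • C) *ᵥ w))) := by
  let L : Matrix (m ⊕ n) (m ⊕ n) ℝ →ₗ[ℝ] ℝ :=
    { toFun := fun X => α ⬝ᵥ ((Matrix.fromCols (1 : Matrix m m ℝ) (0 : Matrix m n ℝ) * X *
        Matrix.fromRows (0 : Matrix m n ℝ) (1 : Matrix n n ℝ)) *ᵥ w)
      map_add' := fun X Y => by
        rw [Matrix.mul_add, Matrix.add_mul, Matrix.add_mulVec, dotProduct_add]
      map_smul' := fun c X => by
        rw [Matrix.mul_smul, Matrix.smul_mul, Matrix.smul_mulVec, dotProduct_smul]; rfl }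
  have hL : ∀ X, L X = α ⬝ᵥ ((Matrix.fromCols (1 : Matrix m m ℝ) (0 : Matrix m n ℝ) * X *
        Matrix.fromRows (0 : Matrix m n ℝ) (1 : Matrix n n ℝ)) *ᵥ w) := fun X => rfl
  have hd : ∀ t : ℝ, HasDerivAt (fun t : ℝ => L (NormedSpace.exp (t • Matrix.fromBlocks A B 0 C) *
      NormedSpace.exp ((u - t) • Matrix.fromBlocks A 0 0 C)))
      (α ⬝ᵥ (NormedSpace.exp (t • A) *ᵥ (B *ᵥ (NormedSpace.exp ((u - t) • C) *ᵥ w)))) t := by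
    intro t
    convert hasDerivAt_linear_duhamel (Matrix.fromBlocks A B 0 C) (Matrix.fromBlocks A 0 0 C) u t L
      using 1
    rw [hL, fromCols_mul_exp_mul_fromRows, ← Matrix.mulVec_mulVec, ← Matrix.mulVec_mulVec]
  rw [intervalIntegral.integral_eq_sub_of_hasDerivAt (fun t _ => hd t)
    ((continuous_vanLoan_integrand A B C u α w).intervalIntegrable _ _)]
  -- The boundary term at t = u is V itself. The one at t = 0 vanishes, since a block-diagonal
  -- exponential has no upper right block.
  have h0 : NormedSpace.exp (u • Matrix.fromBlocks A 0 0 C) *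
      Matrix.fromRows (0 : Matrix m n ℝ) (1 : Matrix n n ℝ) =
      Matrix.fromRows (0 : Matrix m n ℝ) (1 : Matrix n n ℝ) * NormedSpace.exp (u • C) := by
    apply exp_smul_mul_eq_mul_exp_smul
    simp [Matrix.fromBlocks_mul_fromRows, Matrix.fromRows_mul]
  simp only [hL, sub_self, zero_smul, NormedSpace.exp_zero, sub_zero, Matrix.mul_one,
    Matrix.one_mul]
  rw [Matrix.mul_assoc _ (NormedSpace.exp (u • Matrix.fromBlocks A 0 0 C)), h0]
  simp [vanLoan, Matrix.fromRows_mul, Matrix.fromCols_mul_fromRows]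

/-- The two summands of the Kronecker sum commute, so the exponential splits. The maps v ↦ v ⊗ w and
w ↦ v ⊗ w, written as the matrices `R₁ w` and `R₂ v`, intertwine each summand with A or B. -/
theorem exp_smul_kronSum_mulVec_kronVec (A : Matrix m m ℝ) (B : Matrix n n ℝ) (t : ℝ)
    (v : m → ℝ) (w : n → ℝ) :
    NormedSpace.exp (t • kronSum A B) *ᵥ kronVec v w =
      kronVec (NormedSpace.exp (t • A) *ᵥ v) (NormedSpace.exp (t • B) *ᵥ w) := by
  have hcomm : Commute (t • (A ⊗ₖ (1 : Matrix n n ℝ))) (t • ((1 : Matrix m m ℝ) ⊗ₖ B)) := by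
    refine Commute.smul_left (Commute.smul_right ?_ t) t
    change _ * _ = _ * _
    rw [← Matrix.mul_kronecker_mul, ← Matrix.mul_kronecker_mul]
    simp
  let R₁ : (n → ℝ) → Matrix (m × n) m ℝ := fun w =>
    Matrix.of fun p i => (1 : Matrix m m ℝ) p.1 i * w p.2
  let R₂ : (m → ℝ) → Matrix (m × n) n ℝ := fun v =>
    Matrix.of fun p j => v p.1 * (1 : Matrix n n ℝ) p.2 j
  have hR₁ : ∀ v w, R₁ w *ᵥ v = kronVec v w := by
    intro v w; ext p
    simp [R₁, Matrix.mulVec, dotProduct, kronVec, Matrix.one_apply, mul_comm]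
  have hR₂ : ∀ v w, R₂ v *ᵥ w = kronVec v w := by
    intro v w; ext p
    simp [R₂, Matrix.mulVec, dotProduct, kronVec, Matrix.one_apply]
  have hA : ∀ w, (A ⊗ₖ (1 : Matrix n n ℝ)) * R₁ w = R₁ w * A := by
    intro w; ext p i
    simp [R₁, Matrix.mul_apply, Fintype.sum_prod_type, Matrix.one_apply, mul_comm]
  have hB : ∀ v, ((1 : Matrix m m ℝ) ⊗ₖ B) * R₂ v = R₂ v * B := by
    intro v; ext p i
    simp [R₂, Matrix.mul_apply, Fintype.sum_prod_type, Matrix.one_apply, mul_comm]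
  rw [kronSum, smul_add, Matrix.exp_add_of_commute _ _ hcomm, ← Matrix.mulVec_mulVec, ← hR₂ v w,
    Matrix.mulVec_mulVec w, exp_smul_mul_eq_mul_exp_smul (hB v), ← Matrix.mulVec_mulVec, hR₂,
    ← hR₁, Matrix.mulVec_mulVec v, exp_smul_mul_eq_mul_exp_smul (hA _), ← Matrix.mulVec_mulVec, hR₁]

end VanLoan

/-! ### Semigroups of the absorbing generators -/

section Generators

theorem shockMatrix_mulVec {E S : Type*} [Fintype S] [DecidableEq S] (U : Matrix E S ℝ)
    (w : S × S → ℝ) : shockMatrix U *ᵥ w = U *ᵥ fun k => w (k, k) := by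
  ext e
  simp [shockMatrix, Matrix.sum_apply, Matrix.vecMulVec_apply, kronVec, dotProduct,
    Fintype.sum_prod_type, Matrix.mulVec, Pi.single_apply]

/-- The generator row of an absorbing state is zero, so the semigroup row is trivial. -/
theorem exp_smul_apply_of_row_eq_zero {I : Type*} [Fintype I] [DecidableEq I] {G : Matrix I I ℝ}
    {i : I} (h : G i = 0) (t : ℝ) (j : I) :
    NormedSpace.exp (t • G) i j = (1 : Matrix I I ℝ) i j := by
  -- The row eᵢᵀ intertwines the 1 × 1 zero matrix with G, so eᵢᵀ e^{tG} = eᵢᵀ.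
  have := exp_smul_mul_eq_mul_exp_smul (A := (0 : Matrix Unit Unit ℝ)) (B := G)
    (R := Matrix.of fun _ => Pi.single i 1) (by
      ext a b
      simp [Matrix.mul_apply, Pi.single_apply, h]) t
  have := congrFun (congrFun this ()) j
  simp [Matrix.mul_apply, Pi.single_apply] at this
  rw [← this, Matrix.one_apply]
  simp [eq_comm]

/-- The rows of the extended generator sum to zero, so those of its semigroup sum to 1 (`h1`). Its
block on S is e^{tQ} (`h2`), and the cemetery receives the missing mass. -/
theorem exp_smul_absorbing_none {S : Type*} [Fintype S] [DecidableEq S] (Q : Matrix S S ℝ)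
    (t : ℝ) (k : S) :
    NormedSpace.exp (t • absorbing Q) (some k) none =
      1 - (NormedSpace.exp (t • Q) *ᵥ 1) k := by
  have h1 := exp_smul_mul_eq_mul_exp_smul (A := absorbing Q) (B := (0 : Matrix Unit Unit ℝ))
    (R := Matrix.of fun _ _ => 1) (by
      ext a b
      rcases a with _ | a <;> simp [Matrix.mul_apply, absorbing, Fintype.sum_option]) t
  have h2 := exp_smul_mul_eq_mul_exp_smul (A := absorbing Q) (B := Q)
    (R := Matrix.of fun a j => a.elim 0 fun i => (1 : Matrix S S ℝ) i j) (by
      ext a b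
      rcases a with _ | a <;>
        simp [Matrix.mul_apply, absorbing, Fintype.sum_option, Matrix.one_apply]) t
  have h1' := congrFun (congrFun h1 (some k)) ()
  have h2' : ∀ j, NormedSpace.exp (t • absorbing Q) (some k) (some j) =
      NormedSpace.exp (t • Q) k j := by
    intro j
    have := congrFun (congrFun h2 (some k)) j
    simpa [Matrix.mul_apply, Fintype.sum_option, Matrix.one_apply] using this
  simp [Matrix.mul_apply, Fintype.sum_option, h2'] at h1'
  simp [Matrix.mulVec, dotProduct]
  linarith

/-- The upper right block of the semigroup of the joint chain. -/
theorem exp_smul_fromBlocks_inl_inr {E S : Type*} [Fintype E] [Fintype S] [DecidableEq E]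
    [DecidableEq S] (T : Matrix E E ℝ) (U : Matrix E S ℝ) (α : E → ℝ) (t : ℝ) (k : S) :
    ∑ e, α e * NormedSpace.exp (t • Matrix.fromBlocks T U (0 : Matrix S E ℝ) (0 : Matrix S S ℝ))
      (Sum.inl e) (Sum.inr k) =
      ∫ s in (0 : ℝ)..t, α ⬝ᵥ (NormedSpace.exp (s • T) *ᵥ U.col k) := by
  have h := dotProduct_vanLoan_mulVec T U (0 : Matrix S S ℝ) t α (Pi.single k 1)
  simp only [smul_zero, NormedSpace.exp_zero, Matrix.one_mulVec] at h
  simp only [Matrix.mulVec_single_one] at h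
  rw [← h]
  refine Finset.sum_congr rfl fun e _ => ?_
  simp [vanLoan, Matrix.mul_apply, Matrix.one_apply, Matrix.col]

end Generators

/-! ### Hitting times of right-continuous paths -/

section Paths

variable {I Ω : Type*}

/-- The first time at which a process visits the set `A`. -/
noncomputable def hitTime (J : ℝ≥0 → Ω → I) (A : Set I) (ω : Ω) : ℝ≥0∞ :=
  ⨅ (t : ℝ≥0) (_ : J t ω ∈ A), (t : ℝ≥0∞)

theorem hitTime_lt_iff {J : ℝ≥0 → Ω → I} {A : Set I} {ω : Ω} {b : ℝ≥0∞} :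
    hitTime J A ω < b ↔ ∃ t : ℝ≥0, J t ω ∈ A ∧ (t : ℝ≥0∞) < b := by
  simp [hitTime, iInf_lt_iff]

theorem hitTime_le {J : ℝ≥0 → Ω → I} {A : Set I} {ω : Ω} {t : ℝ≥0} (h : J t ω ∈ A) :
    hitTime J A ω ≤ t :=
  iInf₂_le t h

theorem notMem_of_lt_hitTime {J : ℝ≥0 → Ω → I} {A : Set I} {ω : Ω} {t : ℝ≥0}
    (h : (t : ℝ≥0∞) < hitTime J A ω) : J t ω ∉ A :=
  fun hA => (hitTime_le hA).not_gt h

/-- A right-continuous path is constant up to some rational time after `t`. -/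
theorem exists_rat_eq_of_rightCts {j : ℝ≥0 → I} {t : ℝ≥0} (h : ∀ᶠ s in 𝓝[≥] t, j s = j t)
    {b : ℝ≥0} (hb : t < b) :
    ∃ q : ℚ, t < Real.toNNReal q ∧ Real.toNNReal q < b ∧ j (Real.toNNReal q) = j t := by
  obtain ⟨c, hc, hsub⟩ := mem_nhdsGE_iff_exists_Ico_subset.1 h
  obtain ⟨q, -, h1, h2⟩ := (NNReal.lt_iff_exists_rat_btwn t (min b c)).1 (lt_min hb hc)
  exact ⟨q, h1, h2.trans_le (min_le_left _ _), hsub ⟨h1.le, h2.trans_le (min_le_right _ _)⟩⟩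

theorem hitTime_lt_iff_exists_rat {J : ℝ≥0 → Ω → I} {A : Set I} {ω : Ω}
    (hJ : ∀ t, ∀ᶠ s in 𝓝[≥] t, J s ω = J t ω) {b : ℝ≥0∞} :
    hitTime J A ω < b ↔ ∃ q : ℚ, J (Real.toNNReal q) ω ∈ A ∧
      ((Real.toNNReal q : ℝ≥0) : ℝ≥0∞) < b := by
  rw [hitTime_lt_iff]
  constructor
  · rintro ⟨t, hA, htb⟩
    obtain ⟨c, htc, hcb⟩ := ENNReal.lt_iff_exists_nnreal_btwn.1 htb
    obtain ⟨q, -, hq, hqt⟩ := exists_rat_eq_of_rightCts (j := fun s => J s ω) (hJ t)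
      (ENNReal.coe_lt_coe.1 htc)
    exact ⟨q, by rw [hqt]; exact hA, (ENNReal.coe_lt_coe.2 hq).trans hcb⟩
  · rintro ⟨q, h⟩
    exact ⟨_, h⟩

/-- By right-continuity a visit before b can be detected at rational times. Measurability for the
σ-algebra of the process itself is what lets independence pass to hitting times. -/
theorem measurable_hitTime {J : ℝ≥0 → Ω → I} (hJ : ∀ ω t, ∀ᶠ s in 𝓝[≥] t, J s ω = J t ω)
    (A : Set I) : Measurable[pathSigma J] (hitTime J A) := by
  let _ : MeasurableSpace Ω := pathSigma J
  refine measurable_of_Iio fun b => ?_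
  have : hitTime J A ⁻¹' Set.Iio b = ⋃ q : ℚ, {ω | J (Real.toNNReal q) ω ∈ A ∧
      ((Real.toNNReal q : ℝ≥0) : ℝ≥0∞) < b} := by
    ext ω
    simp [hitTime_lt_iff_exists_rat (hJ ω)]
  rw [this]
  refine MeasurableSet.iUnion fun q => ?_
  by_cases hq : ((Real.toNNReal q : ℝ≥0) : ℝ≥0∞) < b
  · simp only [hq, and_true]
    exact le_iSup (fun t => MeasurableSpace.comap (J t) ⊤) (Real.toNNReal q) _ ⟨A, trivial, rfl⟩
  · simp [hq]

/-- A right-continuous path is in `A` at the first time it visits `A`. -/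
theorem mem_of_hitTime_ne_top {J : ℝ≥0 → Ω → I} {A : Set I} {ω : Ω}
    (hJ : ∀ t, ∀ᶠ s in 𝓝[≥] t, J s ω = J t ω) (h : hitTime J A ω ≠ ∞) :
    J (hitTime J A ω).toNNReal ω ∈ A := by
  obtain ⟨c, hc, hsub⟩ := mem_nhdsGE_iff_exists_Ico_subset.1 (hJ (hitTime J A ω).toNNReal)
  have h1 : hitTime J A ω < c := by
    rw [← ENNReal.coe_toNNReal h]
    exact ENNReal.coe_lt_coe.2 hc
  obtain ⟨t, hA, htc⟩ := hitTime_lt_iff.1 h1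
  have h2 : (hitTime J A ω).toNNReal ≤ t := by
    simpa using ENNReal.toNNReal_mono ENNReal.coe_ne_top (hitTime_le hA)
  have h3 : J t ω = J (hitTime J A ω).toNNReal ω := hsub ⟨h2, ENNReal.coe_lt_coe.1 htc⟩
  rwa [← h3]

theorem hitTime_singleton_le_iff {J : ℝ≥0 → Ω → I} {i : I} {ω : Ω}
    (hJ : ∀ t, ∀ᶠ s in 𝓝[≥] t, J s ω = J t ω) (habs : ∀ s t, s ≤ t → J s ω = i → J t ω = i)
    (t : ℝ≥0) : hitTime J {i} ω ≤ t ↔ J t ω = i := by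
  refine ⟨fun h => ?_, fun h => hitTime_le h⟩
  have hne : hitTime J {i} ω ≠ ∞ := ne_top_of_le_ne_top ENNReal.coe_ne_top h
  exact habs _ _ (by simpa using ENNReal.toNNReal_mono ENNReal.coe_ne_top h)
    (mem_of_hitTime_ne_top hJ hne)

theorem pathSigma_le [MeasurableSpace Ω] [Finite I] {J : ℝ≥0 → Ω → I}
    (h : ∀ t i, MeasurableSet {ω | J t ω = i}) : pathSigma J ≤ ‹MeasurableSpace Ω› := by
  refine iSup_le fun t => ?_
  rintro _ ⟨A, -, rfl⟩
  have : J t ⁻¹' A = ⋃ i ∈ A, {ω | J t ω = i} := by ext ω; simp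
  rw [this]
  exact MeasurableSet.biUnion A.to_countable fun i _ => h t i

end Paths

/-! ### Absorption in Markov chains -/

section MarkovChain

variable {I Ω : Type*} [Fintype I] [DecidableEq I] [MeasurableSpace Ω] {P : Measure Ω}
  {J : ℝ≥0 → Ω → I} {ν : I → ℝ} {G : Matrix I I ℝ}

/-- The one-dimensional distributions of a Markov chain. -/
theorem IsMarkovChain.measureReal_eq [IsFiniteMeasure P] (h : IsMarkovChain P J ν G) (t : ℝ≥0)
    (j : I) :
    P.real {ω | J t ω = j} = ∑ i, ν i * NormedSpace.exp ((t : ℝ) • G) i j := by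
  have hU : {ω | J t ω = j} = ⋃ i, {ω | ∀ m, J ((![0, t] : Fin 2 → ℝ≥0) m) ω = ![i, j] m} := by
    ext ω
    simp [Fin.forall_fin_two]
  have hmeas : ∀ i, {ω | ∀ m, J ((![0, t] : Fin 2 → ℝ≥0) m) ω = ![i, j] m} =
      {ω | J 0 ω = i} ∩ {ω | J t ω = j} := by
    intro i; ext ω
    simp [Fin.forall_fin_two]
  rw [hU, measureReal_iUnion_fintype]
  · refine Finset.sum_congr rfl fun i _ => ?_
    rw [h.fdd 1 ![0, t] ![i, j] rfl]
    · simp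
    · rw [Fin.monotone_iff_le_succ]
      simp
  · intro i i' hii'
    refine Set.disjoint_left.2 fun ω h1 h2 => hii' ?_
    exact (h1 0).symm.trans (h2 0)
  · intro i
    rw [hmeas]
    exact (h.measurableSet_eq _ _).inter (h.measurableSet_eq _ _)

/-- Almost surely, a Markov chain never leaves an absorbing state. -/
theorem IsMarkovChain.ae_absorbed [IsFiniteMeasure P] (h : IsMarkovChain P J ν G) {i : I}
    (hi : G i = 0) : ∀ᵐ ω ∂P, ∀ s t, s ≤ t → J s ω = i → J t ω = i := by
  have h1 : ∀ s t : ℝ≥0, s ≤ t → ∀ᵐ ω ∂P, J s ω = i → J t ω = i := by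
    intro s t hst
    -- Such a path has probability containing the factor e^{(t - s)G}(i, b) = 0. Time 0 is included
    -- because the finite-dimensional distributions start there.
    have h2 : ∀ a b : I, b ≠ i → ∀ᵐ ω ∂P,
        ¬ ∀ m, J ((![0, s, t] : Fin 3 → ℝ≥0) m) ω = ![a, i, b] m := by
      intro a b hb
      have h3 := h.fdd 2 ![0, s, t] ![a, i, b] rfl (by
        rw [Fin.monotone_iff_le_succ]
        simp [Fin.forall_fin_two, hst])
      rw [ae_iff]
      simp only [not_not]
      rw [← measureReal_eq_zero_iff, h3]
      simp [Fin.prod_univ_two, exp_smul_apply_of_row_eq_zero hi, hb.symm]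
    have h4 : ∀ᵐ ω ∂P, ∀ a b : I, b ≠ i →
        ¬ ∀ m, J ((![0, s, t] : Fin 3 → ℝ≥0) m) ω = ![a, i, b] m := by
      simp only [ae_all_iff]
      exact h2
    filter_upwards [h4] with ω hω hs
    by_contra ht
    refine hω (J 0 ω) (J t ω) ht fun m => ?_
    fin_cases m
    · rfl
    · exact hs
    · rfl
  -- A single null set serves the countably many rational pairs; right-continuity then reaches all
  -- times.
  have h5 : ∀ᵐ ω ∂P, ∀ p q : ℚ, Real.toNNReal p ≤ Real.toNNReal q →
      J (Real.toNNReal p) ω = i → J (Real.toNNReal q) ω = i := by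
    simp only [ae_all_iff]
    exact fun p q hpq => h1 _ _ hpq
  filter_upwards [h5] with ω hω s t hst hs
  rcases hst.eq_or_lt with rfl | hst
  · exact hs
  obtain ⟨p, -, hpt, hp⟩ := exists_rat_eq_of_rightCts (j := fun s => J s ω) (h.rightCts ω s) hst
  obtain ⟨q, htq, -, hq⟩ := exists_rat_eq_of_rightCts (j := fun s => J s ω) (h.rightCts ω t)
    (lt_add_one t)
  exact hq.symm.trans (hω p q (hpt.trans htq).le (hp.trans hs))

/-- The distribution of the absorption time of a Markov chain. -/
theorem IsMarkovChain.measureReal_hitTime_le [IsFiniteMeasure P] (h : IsMarkovChain P J ν G)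
    {i : I} (hi : G i = 0) (t : ℝ≥0) :
    P.real {ω | hitTime J {i} ω ≤ t} = ∑ j, ν j * NormedSpace.exp ((t : ℝ) • G) j i := by
  rw [← h.measureReal_eq]
  refine measureReal_congr ?_
  filter_upwards [h.ae_absorbed hi] with ω hω
  exact propext (hitTime_singleton_le_iff (h.rightCts ω) hω t)

theorem IsMarkovChain.measurable_hitTime (h : IsMarkovChain P J ν G) (A : Set I) :
    Measurable (hitTime J A) :=
  (CSPH.measurable_hitTime h.rightCts A).mono (pathSigma_le h.measurableSet_eq) le_rfl

end MarkovChain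

/-! ### Lifetimes in terms of shock and absorption times -/

section Lifetime

variable {E S Ω : Type*}

theorem shockTime_eq_hitTime (J : ℝ≥0 → Ω → E ⊕ S) :
    shockTime J = hitTime J {x | ∀ e, x ≠ Sum.inl e} := rfl

/-- After a shock, the time spent in `S` is the absorption time of the post-shock process. -/
theorem timeInS_splice {J : ℝ≥0 → Ω → E ⊕ S} {Y : ℝ≥0 → Ω → Option S} {ω : Ω}
    (hY : ∀ t, ∀ᶠ s in 𝓝[≥] t, Y s ω = Y t ω)
    (habs : ∀ s t, s ≤ t → Y s ω = none → Y t ω = none) (hτ : shockTime J ω ≠ ∞) :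
    timeInS (splice J Y) ω = hitTime Y {none} ω := by
  set τ := (shockTime J ω).toNNReal with hτ'
  have hτe : shockTime J ω = τ := (ENNReal.coe_toNNReal hτ).symm
  -- The instant τ, at which the spliced process still follows J₁₂, is removed as a null set.
  have key : {t : ℝ | 0 ≤ t ∧ ∃ k : S, splice J Y t.toNNReal ω = some (Sum.inr k)} \ {(τ : ℝ)} =
      {t : ℝ | (τ : ℝ) < t ∧ ENNReal.ofReal (t - τ) < hitTime Y {none} ω} := by
    ext t
    simp only [Set.mem_sdiff, Set.mem_ofPred_eq, Set.mem_singleton_iff]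
    rcases lt_trichotomy t τ with h | h | h
    · refine iff_of_false ?_ fun hh => hh.1.not_gt h
      rintro ⟨⟨h0, k, hk⟩, -⟩
      have h1 : (t.toNNReal : ℝ≥0∞) < shockTime J ω := by
        rw [hτe, ENNReal.coe_lt_coe, ← NNReal.coe_lt_coe, Real.coe_toNNReal _ h0]
        exact h
      rw [splice, if_pos h1.le, Option.some_inj] at hk
      refine notMem_of_lt_hitTime (A := {x : E ⊕ S | ∀ e, x ≠ Sum.inl e}) h1 ?_
      simp [hk]
    · simp [h]
    · have h0 : 0 ≤ t := τ.2.trans h.le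
      have h1 : ¬ (t.toNNReal : ℝ≥0∞) ≤ shockTime J ω := by
        rw [hτe, ENNReal.coe_le_coe, ← NNReal.coe_le_coe, Real.coe_toNNReal _ h0]
        exact h.not_ge
      have h2 : t.toNNReal - τ = (t - τ).toNNReal := by
        rw [← NNReal.coe_inj, NNReal.coe_sub (NNReal.le_toNNReal_of_coe_le h.le),
          Real.coe_toNNReal _ h0, Real.coe_toNNReal _ (sub_nonneg.2 h.le)]
      have h3 := hitTime_singleton_le_iff hY habs (t - τ).toNNReal
      rw [splice, if_neg h1, ← hτ', h2, ENNReal.ofReal, ← not_le (a := hitTime Y {none} ω), h3]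
      cases hYt : Y (t - τ).toNNReal ω with
      | none => simp
      | some k => simp [h, h0, h.ne']
  rw [timeInS, ← measure_sdiff_null (measure_singleton (τ : ℝ)), key]
  by_cases htop : hitTime Y {none} ω = ∞
  · simp only [htop, ENNReal.ofReal_lt_top, and_true]
    exact Real.volume_Ioi
  · have : {t : ℝ | (τ : ℝ) < t ∧ ENNReal.ofReal (t - τ) < hitTime Y {none} ω} =
        Set.Ioo (τ : ℝ) (τ + (hitTime Y {none} ω).toReal) := by
      ext t
      simp only [Set.mem_ofPred_eq, Set.mem_Ioo]
      refine and_congr_right fun h => ?_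
      rw [ENNReal.ofReal_lt_iff_lt_toReal (sub_nonneg.2 h.le) htop, sub_lt_iff_lt_add']
    rw [this, Real.volume_Ioo, add_sub_cancel_left, ENNReal.ofReal_toReal htop]

/-- The first conjunct is not redundant: `ENNReal.ofReal` truncates a negative remaining time to 0,
so the second one alone could hold even when a τ > z. -/
theorem scaledLifetime_le_iff {J : ℝ≥0 → Ω → E ⊕ S} {Y : ℝ≥0 → Ω → Option S} {ω : Ω}
    (hY : ∀ t, ∀ᶠ s in 𝓝[≥] t, Y s ω = Y t ω)
    (habs : ∀ s t, s ≤ t → Y s ω = none → Y t ω = none) (hτ : shockTime J ω ≠ ∞)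
    {a z : ℝ} (ha : 0 ≤ a) (hz : 0 ≤ z) :
    scaledLifetime J Y a ω ≤ ENNReal.ofReal z ↔ a * (shockTime J ω).toReal ≤ z ∧
      hitTime Y {none} ω ≤ ENNReal.ofReal (z - a * (shockTime J ω).toReal) := by
  have h0 : 0 ≤ a * (shockTime J ω).toReal := mul_nonneg ha ENNReal.toReal_nonneg
  rw [scaledLifetime, timeInS_splice hY habs hτ, ← ENNReal.ofReal_toReal hτ,
    ← ENNReal.ofReal_mul ha, ENNReal.toReal_ofReal ENNReal.toReal_nonneg, ENNReal.ofReal_sub _ h0]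
  constructor
  · intro h
    exact ⟨(ENNReal.ofReal_le_ofReal_iff hz).1 (le_self_add.trans h),
      ENNReal.le_sub_of_add_le_left ENNReal.ofReal_ne_top h⟩
  · rintro ⟨h1, h2⟩
    refine (add_le_add_right h2 _).trans ?_
    rw [add_tsub_cancel_of_le (ENNReal.ofReal_le_ofReal h1)]

end Lifetime

/-! ### Joint law of the shock time and the state entered -/

section Shock

variable {E S Ω : Type*}

/-- The path is frozen after the shock, so its position at time t records both whether the shock has
occurred and which state it led to. -/
theorem mem_shockEvent_and_shockTime_le_iff {J : ℝ≥0 → Ω → E ⊕ S} {ω : Ω}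
    (hJ : ∀ t, ∀ᶠ s in 𝓝[≥] t, J s ω = J t ω)
    (habs : ∀ (k : S) s t, s ≤ t → J s ω = Sum.inr k → J t ω = Sum.inr k) (k : S) (t : ℝ≥0) :
    (ω ∈ shockEvent J k ∧ shockTime J ω ≤ t) ↔ J t ω = Sum.inr k := by
  constructor
  · rintro ⟨⟨hne, hk⟩, hle⟩
    exact habs k _ _ (by simpa using ENNReal.toNNReal_mono ENNReal.coe_ne_top hle) hk
  · intro hk
    have hle : shockTime J ω ≤ t := hitTime_le (A := {x | ∀ e, x ≠ Sum.inl e}) (by simp [hk])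
    have hne : shockTime J ω ≠ ∞ := ne_top_of_le_ne_top ENNReal.coe_ne_top hle
    refine ⟨⟨hne, ?_⟩, hle⟩
    have hmem := mem_of_hitTime_ne_top (A := {x | ∀ e, x ≠ Sum.inl e}) hJ hne
    rw [← shockTime_eq_hitTime] at hmem
    cases hJτ : J (shockTime J ω).toNNReal ω with
    | inl e => exact absurd hJτ (hmem e)
    | inr k' =>
      have := habs k' _ _ (by simpa using ENNReal.toNNReal_mono ENNReal.coe_ne_top hle) hJτ
      rw [← hk, this]

theorem exists_mem_shockEvent {J : ℝ≥0 → Ω → E ⊕ S} {ω : Ω}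
    (hJ : ∀ t, ∀ᶠ s in 𝓝[≥] t, J s ω = J t ω) (hne : shockTime J ω ≠ ∞) :
    ∃ k, ω ∈ shockEvent J k := by
  have hmem := mem_of_hitTime_ne_top (A := {x | ∀ e, x ≠ Sum.inl e}) hJ hne
  rw [← shockTime_eq_hitTime] at hmem
  cases hJτ : J (shockTime J ω).toNNReal ω with
  | inl e => exact absurd hJτ (hmem e)
  | inr k => exact ⟨k, hne, hJτ⟩

/-- The density of the shock time on the event that the state `k` is entered at the shock. -/
noncomputable def shockDensity [Fintype E] [DecidableEq E] (α : E → ℝ) (T : Matrix E E ℝ)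
    (U : Matrix E S ℝ) (k : S) (t : ℝ) : ℝ :=
  α ⬝ᵥ (NormedSpace.exp (t • T) *ᵥ U.col k)

theorem continuous_shockDensity [Fintype E] [DecidableEq E] (α : E → ℝ) (T : Matrix E E ℝ)
    (U : Matrix E S ℝ) (k : S) : Continuous (shockDensity α T U k) :=
  continuous_const.dotProduct ((continuous_exp_smul T).matrix_mulVec continuous_const)

variable [Fintype E] [Fintype S] [DecidableEq E] [DecidableEq S] [MeasurableSpace Ω]
  {P : Measure Ω} {J : ℝ≥0 → Ω → E ⊕ S} {α : E → ℝ} {T : Matrix E E ℝ} {U : Matrix E S ℝ}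

theorem ae_shock_absorbed [IsFiniteMeasure P]
    (h : IsMarkovChain P J (Sum.elim α 0) (Matrix.fromBlocks T U 0 0)) :
    ∀ᵐ ω ∂P, ∀ (k : S) s t, s ≤ t → J s ω = Sum.inr k → J t ω = Sum.inr k := by
  rw [ae_all_iff]
  exact fun k => h.ae_absorbed (by ext j; rcases j with j | j <;> simp)

theorem nullMeasurableSet_shockEvent [IsFiniteMeasure P]
    (h : IsMarkovChain P J (Sum.elim α 0) (Matrix.fromBlocks T U 0 0)) (k : S) :
    NullMeasurableSet (shockEvent J k) P := by
  have hm : MeasurableSet (⋃ n : ℕ, {ω | J n ω = Sum.inr k}) :=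
    MeasurableSet.iUnion fun n => h.measurableSet_eq _ _
  refine hm.nullMeasurableSet.congr ?_
  filter_upwards [ae_shock_absorbed h] with ω hω
  refine propext ?_
  change (ω ∈ ⋃ n : ℕ, {ω | J n ω = Sum.inr k}) ↔ ω ∈ shockEvent J k
  simp only [Set.mem_iUnion, Set.mem_ofPred_eq,
    ← mem_shockEvent_and_shockTime_le_iff (h.rightCts ω) hω]
  constructor
  · rintro ⟨n, hn, -⟩
    exact hn
  · intro hk
    obtain ⟨n, hn⟩ := ENNReal.exists_nat_gt hk.1
    exact ⟨n, hk, by simpa using hn.le⟩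

theorem measurable_shockTime
    (h : IsMarkovChain P J (Sum.elim α 0) (Matrix.fromBlocks T U 0 0)) :
    Measurable (shockTime J) := by
  rw [shockTime_eq_hitTime]
  exact h.measurable_hitTime _

theorem measureReal_shockTime_le [IsFiniteMeasure P]
    (h : IsMarkovChain P J (Sum.elim α 0) (Matrix.fromBlocks T U 0 0)) (k : S) {t : ℝ}
    (ht : 0 ≤ t) :
    P.real ((fun ω => (shockTime J ω).toReal) ⁻¹' Set.Iic t ∩ shockEvent J k) =
      ∫ s in (0 : ℝ)..t, shockDensity α T U k s := by
  have h1 := h.measureReal_eq t.toNNReal (Sum.inr k)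
  rw [Real.coe_toNNReal _ ht, Fintype.sum_sum_type] at h1
  simp only [Sum.elim_inl, Sum.elim_inr, Pi.zero_apply, zero_mul, Finset.sum_const_zero,
    add_zero] at h1
  rw [exp_smul_fromBlocks_inl_inr] at h1
  unfold shockDensity
  rw [← h1]
  refine measureReal_congr ?_
  filter_upwards [ae_shock_absorbed h] with ω hω
  refine propext (Iff.trans ?_ (mem_shockEvent_and_shockTime_le_iff (h.rightCts ω) hω k _))
  change ((shockTime J ω).toReal ≤ t ∧ ω ∈ shockEvent J k) ↔ _
  rw [and_comm]
  refine and_congr_right fun hk => ?_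
  -- Finiteness of τ on the shock event matters: `toReal` would send ∞ to 0 ≤ t.
  exact (ENNReal.le_ofReal_iff_toReal_le hk.1 ht).symm

/-- The density is the derivative of the monotone function t ↦ P(τ ≤ t, K = k). Taking t > 0
provides a neighbourhood on which the integral formula for it is valid. -/
theorem shockDensity_nonneg [IsFiniteMeasure P]
    (h : IsMarkovChain P J (Sum.elim α 0) (Matrix.fromBlocks T U 0 0)) (k : S) {t : ℝ}
    (ht : 0 < t) : 0 ≤ shockDensity α T U k t := by
  have hmono : Monotone fun t : ℝ =>
      P.real ((fun ω => (shockTime J ω).toReal) ⁻¹' Set.Iic t ∩ shockEvent J k) := fun s t hst =>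
    measureReal_mono (Set.inter_subset_inter_left _
      (Set.preimage_mono (Set.Iic_subset_Iic.2 hst)))
  have hd : HasDerivAt (fun t : ℝ => ∫ s in (0 : ℝ)..t, shockDensity α T U k s)
      (shockDensity α T U k t) t :=
    (continuous_shockDensity α T U k).integral_hasStrictDerivAt 0 t |>.hasDerivAt
  have hd' : HasDerivAt (fun t : ℝ =>
      P.real ((fun ω => (shockTime J ω).toReal) ⁻¹' Set.Iic t ∩ shockEvent J k))
      (shockDensity α T U k t) t := by
    refine hd.congr_of_eventuallyEq ?_
    filter_upwards [eventually_gt_nhds ht] with s hs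
    exact measureReal_shockTime_le h k hs.le
  rw [← hd'.deriv]
  exact hmono.deriv_nonneg

/-- Finite measures on ℝ are determined by their values on the half-lines `Set.Iic t`, which are the
integrals already computed. -/
theorem map_shockTime_restrict [IsFiniteMeasure P]
    (h : IsMarkovChain P J (Sum.elim α 0) (Matrix.fromBlocks T U 0 0)) (k : S) :
    (P.restrict (shockEvent J k)).map (fun ω => (shockTime J ω).toReal) =
      (volume.restrict (Set.Ioi 0)).withDensity
        fun t => ENNReal.ofReal (shockDensity α T U k t) := by
  have hτ : Measurable fun ω => (shockTime J ω).toReal := (measurable_shockTime h).ennreal_toReal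
  refine Measure.ext_of_Iic _ _ fun t => ?_
  rw [Measure.map_apply hτ measurableSet_Iic, Measure.restrict_apply (hτ measurableSet_Iic),
    withDensity_apply _ measurableSet_Iic, Measure.restrict_restrict measurableSet_Iic]
  rcases lt_or_ge t 0 with ht | ht
  · have h1 : (fun ω => (shockTime J ω).toReal) ⁻¹' Set.Iic t = ∅ := by
      ext ω
      simp [ht.trans_le ENNReal.toReal_nonneg]
    have h2 : Set.Iic t ∩ Set.Ioi 0 = ∅ := by
      ext x
      simp only [Set.mem_inter_iff, Set.mem_Iic, Set.mem_Ioi, Set.mem_empty_iff_false, iff_false]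
      intro hx
      linarith
    simp [h1, h2]
  · rw [Set.inter_comm (Set.Iic t), Set.Ioi_inter_Iic, ← ofReal_integral_eq_lintegral_ofReal,
      ← intervalIntegral.integral_of_le ht, ← measureReal_shockTime_le h k ht, ofReal_measureReal]
    · exact (continuous_shockDensity α T U k).integrableOn_Ioc
    · filter_upwards [ae_restrict_mem measurableSet_Ioc] with s hs
      exact shockDensity_nonneg h k hs.1

theorem integral_map_shockTime [IsFiniteMeasure P]
    (h : IsMarkovChain P J (Sum.elim α 0) (Matrix.fromBlocks T U 0 0)) (k : S) {u : ℝ}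
    (hu : 0 ≤ u) (g : ℝ → ℝ) :
    ∫ t, (Set.Icc 0 u).indicator g t
        ∂(P.restrict (shockEvent J k)).map (fun ω => (shockTime J ω).toReal) =
      ∫ t in (0 : ℝ)..u, shockDensity α T U k t * g t := by
  rw [map_shockTime_restrict h, integral_withDensity_eq_integral_toReal_smul
    (continuous_shockDensity α T U k).measurable.ennreal_ofReal (by simp),
    intervalIntegral.integral_of_le hu, ← integral_indicator measurableSet_Ioc,
    ← integral_indicator measurableSet_Ioi]
  congr 1
  ext t
  by_cases h0 : 0 < t
  · by_cases htu : t ≤ u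
    · rw [Set.indicator_of_mem (Set.mem_Ioi.2 h0),
        Set.indicator_of_mem (Set.mem_Icc.2 ⟨h0.le, htu⟩),
        Set.indicator_of_mem (Set.mem_Ioc.2 ⟨h0, htu⟩),
        ENNReal.toReal_ofReal (shockDensity_nonneg h k h0), smul_eq_mul]
    · simp [Set.indicator, h0, htu]
  · simp [Set.indicator, h0]

end Shock

/-! ### Independent thresholds by Fubini -/

section Conditional

/-- The measure of a region cut out by two independent thresholds, given a third independent
variable. -/
theorem measureReal_prod_thresholds {Ω : Type*} [MeasurableSpace Ω] {P : Measure Ω}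
    [IsProbabilityMeasure P] {τ : Ω → ℝ} {σ₁ σ₂ : Ω → ℝ≥0∞} (hτ : Measurable τ)
    (hσ₁ : Measurable σ₁) (hσ₂ : Measurable σ₂)
    (hind : IndepFun τ (fun ω => (σ₁ ω, σ₂ ω)) P) (hind' : IndepFun σ₁ σ₂ P)
    {I : Set ℝ} (hI : MeasurableSet I) {c₁ c₂ : ℝ → ℝ≥0∞} (hc₁ : Measurable c₁)
    (hc₂ : Measurable c₂) :
    P.real {ω | τ ω ∈ I ∧ σ₁ ω ≤ c₁ (τ ω) ∧ σ₂ ω ≤ c₂ (τ ω)} =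
      ∫ t, I.indicator (fun t => P.real {ω | σ₁ ω ≤ c₁ t} * P.real {ω | σ₂ ω ≤ c₂ t}) t
        ∂P.map τ := by
  set A : Set (ℝ × ℝ≥0∞ × ℝ≥0∞) := {p | p.1 ∈ I ∧ p.2.1 ≤ c₁ p.1 ∧ p.2.2 ≤ c₂ p.1} with hA
  have hAm : MeasurableSet A :=
    (measurable_fst hI).inter
      ((measurableSet_le (measurable_fst.comp measurable_snd) (hc₁.comp measurable_fst)).inter
        (measurableSet_le (measurable_snd.comp measurable_snd) (hc₂.comp measurable_fst)))
  have hσ : Measurable fun ω => (σ₁ ω, σ₂ ω) := hσ₁.prodMk hσ₂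
  have : IsProbabilityMeasure (P.map fun ω => (σ₁ ω, σ₂ ω)) :=
    Measure.isProbabilityMeasure_map hσ.aemeasurable
  have : IsProbabilityMeasure (P.map τ) := Measure.isProbabilityMeasure_map hτ.aemeasurable
  have h1 : P {ω | τ ω ∈ I ∧ σ₁ ω ≤ c₁ (τ ω) ∧ σ₂ ω ≤ c₂ (τ ω)} =
      ((P.map τ).prod (P.map fun ω => (σ₁ ω, σ₂ ω))) A := by
    rw [← hind.map_prod_eq_prod_map_map hτ.aemeasurable hσ.aemeasurable,
      Measure.map_apply (hτ.prodMk hσ) hAm]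
    rfl
  -- Integrate over τ first: each section of A is a rectangle, or empty when t is outside I.
  rw [measureReal_def, h1, Measure.prod_apply hAm, ← integral_toReal
    (measurable_measure_prodMk_left hAm).aemeasurable (by simp)]
  refine integral_congr_ae (Eventually.of_forall fun t => ?_)
  simp only
  by_cases ht : t ∈ I
  · rw [Set.indicator_of_mem ht, Measure.map_apply hσ (measurable_prodMk_left hAm)]
    have h2 : (fun ω => (σ₁ ω, σ₂ ω)) ⁻¹' (Prod.mk t ⁻¹' A) =
        σ₁ ⁻¹' Set.Iic (c₁ t) ∩ σ₂ ⁻¹' Set.Iic (c₂ t) := by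
      ext ω
      simp [hA, ht]
    rw [h2, hind'.measure_inter_preimage_eq_mul _ _ measurableSet_Iic measurableSet_Iic,
      ENNReal.toReal_mul]
    rfl
  · rw [Set.indicator_of_notMem ht]
    have h2 : Prod.mk t ⁻¹' A = ∅ := by
      ext p
      simp [hA, ht]
    simp [h2]

theorem iIndepFun_of_iIndep {Ω β : Type*} [MeasurableSpace Ω] [MeasurableSpace β] {P : Measure Ω}
    {m₀ m₁ m₂ : MeasurableSpace Ω} (h : iIndep ![m₀, m₁, m₂] P) {f₀ f₁ f₂ : Ω → β}
    (h₀ : Measurable[m₀] f₀) (h₁ : Measurable[m₁] f₁) (h₂ : Measurable[m₂] f₂) :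
    iIndepFun ![f₀, f₁, f₂] P := by
  refine iIndep_of_iIndep_of_le h fun i => ?_
  fin_cases i
  · exact h₀.comap_le
  · exact h₁.comap_le
  · exact h₂.comap_le

end Conditional

theorem integral_mul_one_sub_mul_one_sub {f g h : ℝ → ℝ} (hf : Continuous f) (hg : Continuous g)
    (hh : Continuous h) (a b : ℝ) :
    ∫ t in a..b, f t * ((1 - g t) * (1 - h t)) =
      (∫ t in a..b, f t) - (∫ t in a..b, f t * g t) - (∫ t in a..b, f t * h t) +
        ∫ t in a..b, f t * (g t * h t) := by
  rw [← intervalIntegral.integral_sub, ← intervalIntegral.integral_sub,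
    ← intervalIntegral.integral_add]
  rotate_left
  iterate 6 exact Continuous.intervalIntegrable (by fun_prop) _ _
  refine intervalIntegral.integral_congr fun t _ => ?_
  ring

theorem dotProduct_exp_mulVec_mulVec {E S : Type*} [Fintype E] [DecidableEq E] [Fintype S]
    (α : E → ℝ) (T : Matrix E E ℝ) (U : Matrix E S ℝ) (t : ℝ) (v : S → ℝ) :
    α ⬝ᵥ (NormedSpace.exp (t • T) *ᵥ (U *ᵥ v)) = ∑ k, shockDensity α T U k t * v k := by
  rw [Matrix.dotProduct_mulVec, Matrix.dotProduct_mulVec, dotProduct]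
  refine Finset.sum_congr rfl fun k _ => ?_
  rw [shockDensity, Matrix.dotProduct_mulVec]
  rfl

/-! ### The joint distribution function -/

section Main

variable {E S Ω : Type*} [Fintype E] [Fintype S] [DecidableEq E] [DecidableEq S]
  [MeasurableSpace Ω] {P : Measure Ω} {J : ℝ≥0 → Ω → E ⊕ S} {Y₁ Y₂ : ℝ≥0 → Ω → Option S}
  {α : E → ℝ} {T : Matrix E E ℝ} {U : Matrix E S ℝ} {Q₁ Q₂ : Matrix S S ℝ}

theorem measureReal_absorption_le [IsFiniteMeasure P] {Y : ℝ≥0 → Ω → Option S} {Q : Matrix S S ℝ}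
    {k : S} (h : IsMarkovChain P Y (Pi.single (some k) 1) (absorbing Q)) {r : ℝ} (hr : 0 ≤ r) :
    P.real {ω | hitTime Y {none} ω ≤ ENNReal.ofReal r} =
      1 - (NormedSpace.exp (r • Q) *ᵥ 1) k := by
  have h1 := h.measureReal_hitTime_le (i := none) (by ext j; simp [absorbing]) r.toNNReal
  rw [Real.coe_toNNReal _ hr] at h1
  rw [← exp_smul_absorbing_none, ENNReal.ofReal, h1]
  simp [Pi.single_apply]

theorem le_scaledMin_iff {a₁ a₂ : ℝ} (ha₁ : 0 < a₁) (ha₂ : 0 < a₂) {z₁ z₂ t : ℝ} :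
    t ≤ scaledMin a₁ a₂ z₁ z₂ ↔ a₁ * t ≤ z₁ ∧ a₂ * t ≤ z₂ := by
  rw [scaledMin, le_min_iff, le_div_iff₀' ha₁, le_div_iff₀' ha₂]

/-- The joint distribution function on the event that the shock leads to the state `k`. -/
theorem IsCommonShock.measureReal_shockEvent_inter [IsProbabilityMeasure P]
    (h : IsCommonShock P J Y₁ Y₂ α T U Q₁ Q₂) {a₁ a₂ : ℝ} (ha₁ : 0 < a₁) (ha₂ : 0 < a₂)
    {z₁ z₂ : ℝ} (hz₁ : 0 ≤ z₁) (hz₂ : 0 ≤ z₂) (k : S) :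
    P.real ({ω | scaledLifetime J Y₁ a₁ ω ≤ ENNReal.ofReal z₁ ∧
        scaledLifetime J Y₂ a₂ ω ≤ ENNReal.ofReal z₂} ∩ shockEvent J k) =
      ∫ t in (0 : ℝ)..scaledMin a₁ a₂ z₁ z₂, shockDensity α T U k t *
        ((1 - (NormedSpace.exp ((z₁ - a₁ * t) • Q₁) *ᵥ 1) k) *
          (1 - (NormedSpace.exp ((z₂ - a₂ * t) • Q₂) *ᵥ 1) k)) := by
  set u := scaledMin a₁ a₂ z₁ z₂ with hu
  have hu0 : 0 ≤ u := (le_scaledMin_iff ha₁ ha₂).2 (by simp [hz₁, hz₂])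
  rw [← integral_map_shockTime h.joint k hu0]
  -- On a null shock event the conditional assumptions say nothing, but both sides vanish.
  by_cases hP : P (shockEvent J k) = 0
  · rw [Measure.restrict_eq_zero.2 hP]
    simp [measureReal_def, measure_mono_null Set.inter_subset_right hP]
  have h₁ := h.post₁ k hP
  have h₂ := h.post₂ k hP
  have : IsProbabilityMeasure P[|shockEvent J k] := cond_isProbabilityMeasure hP
  have hrestrict : P.restrict (shockEvent J k) = P (shockEvent J k) • P[|shockEvent J k] := by
    rw [ProbabilityTheory.cond, smul_smul, ENNReal.mul_inv_cancel hP (measure_ne_top _ _), one_smul]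
  have hτ : Measurable fun ω => (shockTime J ω).toReal :=
    (measurable_shockTime h.joint).ennreal_toReal
  have hσ₁ := h₁.measurable_hitTime {none}
  have hσ₂ := h₂.measurable_hitTime {none}
  have hind := iIndepFun_of_iIndep (h.indep k hP)
    (measurable_hitTime h.joint.rightCts {x | ∀ e, x ≠ Sum.inl e})
    (measurable_hitTime h₁.rightCts {none}) (measurable_hitTime h₂.rightCts {none})
  have hmeas : ∀ i, Measurable ((![hitTime J {x | ∀ e, x ≠ Sum.inl e}, hitTime Y₁ {none},
      hitTime Y₂ {none}] : Fin 3 → Ω → ℝ≥0∞) i) := by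
    intro i
    fin_cases i
    · exact measurable_shockTime h.joint
    · exact hσ₁
    · exact hσ₂
  have hind₁₂ : IndepFun (hitTime Y₁ {none}) (hitTime Y₂ {none}) P[|shockEvent J k] :=
    hind.indepFun (i := 1) (j := 2) (by decide)
  have hindτ : IndepFun (fun ω => (shockTime J ω).toReal)
      (fun ω => (hitTime Y₁ {none} ω, hitTime Y₂ {none} ω)) P[|shockEvent J k] :=
    ((hind.indepFun_prodMk hmeas 1 2 0 (by decide) (by decide)).symm).comp
      (φ := ENNReal.toReal) (ψ := id) ENNReal.measurable_toReal measurable_id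
  have key := measureReal_prod_thresholds hτ hσ₁ hσ₂ hindτ hind₁₂
    (measurableSet_Icc (a := (0 : ℝ)) (b := u))
    (c₁ := fun t => ENNReal.ofReal (z₁ - a₁ * t)) (c₂ := fun t => ENNReal.ofReal (z₂ - a₂ * t))
    (by fun_prop) (by fun_prop)
  have hleft : P.real ({ω | scaledLifetime J Y₁ a₁ ω ≤ ENNReal.ofReal z₁ ∧
        scaledLifetime J Y₂ a₂ ω ≤ ENNReal.ofReal z₂} ∩ shockEvent J k) =
      (P (shockEvent J k)).toReal * P[|shockEvent J k].real
        {ω | (shockTime J ω).toReal ∈ Set.Icc 0 u ∧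
          hitTime Y₁ {none} ω ≤ ENNReal.ofReal (z₁ - a₁ * (shockTime J ω).toReal) ∧
          hitTime Y₂ {none} ω ≤ ENNReal.ofReal (z₂ - a₂ * (shockTime J ω).toReal)} := by
    have hnull := nullMeasurableSet_shockEvent h.joint k
    rw [measureReal_def, ← Measure.restrict_apply₀' hnull, hrestrict,
      Measure.smul_apply, smul_eq_mul, ENNReal.toReal_mul]
    change _ * P[|shockEvent J k].real _ = _
    congr 1
    refine measureReal_congr ?_
    filter_upwards [ae_cond_mem₀ hnull, h₁.ae_absorbed (i := none) (by ext j; simp [absorbing]),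
      h₂.ae_absorbed (i := none) (by ext j; simp [absorbing])] with ω hω habs₁ habs₂
    refine propext ?_
    change (scaledLifetime J Y₁ a₁ ω ≤ ENNReal.ofReal z₁ ∧
        scaledLifetime J Y₂ a₂ ω ≤ ENNReal.ofReal z₂) ↔
      ((0 ≤ (shockTime J ω).toReal ∧ (shockTime J ω).toReal ≤ u) ∧ _ ∧ _)
    rw [scaledLifetime_le_iff (h₁.rightCts ω) habs₁ hω.1 ha₁.le hz₁,
      scaledLifetime_le_iff (h₂.rightCts ω) habs₂ hω.1 ha₂.le hz₂, hu, le_scaledMin_iff ha₁ ha₂]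
    have : 0 ≤ (shockTime J ω).toReal := ENNReal.toReal_nonneg
    -- The range condition τ ≤ u is exactly the pair aᵢ τ ≤ zᵢ.
    tauto
  rw [hleft, key, hrestrict, Measure.map_smul, integral_smul_measure, smul_eq_mul]
  congr 2
  ext t
  by_cases ht : t ∈ Set.Icc 0 u
  · rw [Set.indicator_of_mem ht, Set.indicator_of_mem ht]
    obtain ⟨h1, h2⟩ := (le_scaledMin_iff ha₁ ha₂).1 ht.2
    rw [measureReal_absorption_le h₁ (sub_nonneg.2 h1),
      measureReal_absorption_le h₂ (sub_nonneg.2 h2)]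
  · rw [Set.indicator_of_notMem ht, Set.indicator_of_notMem ht]

theorem IsCommonShock.measureReal_scaledLifetime_le [IsProbabilityMeasure P]
    (h : IsCommonShock P J Y₁ Y₂ α T U Q₁ Q₂) {a₁ a₂ : ℝ} (ha₁ : 0 < a₁) (ha₂ : 0 < a₂)
    {z₁ z₂ : ℝ} (hz₁ : 0 ≤ z₁) (hz₂ : 0 ≤ z₂) :
    P.real {ω | scaledLifetime J Y₁ a₁ ω ≤ ENNReal.ofReal z₁ ∧
        scaledLifetime J Y₂ a₂ ω ≤ ENNReal.ofReal z₂} =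
      ∑ k, ∫ t in (0 : ℝ)..scaledMin a₁ a₂ z₁ z₂, shockDensity α T U k t *
        ((1 - (NormedSpace.exp ((z₁ - a₁ * t) • Q₁) *ᵥ 1) k) *
          (1 - (NormedSpace.exp ((z₂ - a₂ * t) • Q₂) *ᵥ 1) k)) := by
  have hcover : {ω | scaledLifetime J Y₁ a₁ ω ≤ ENNReal.ofReal z₁ ∧
      scaledLifetime J Y₂ a₂ ω ≤ ENNReal.ofReal z₂} ⊆ ⋃ k, shockEvent J k := by
    rintro ω ⟨hω, -⟩
    rw [Set.mem_iUnion]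
    -- Without a shock X₁ is infinite, because a₁ > 0.
    refine exists_mem_shockEvent (h.joint.rightCts ω) fun htop => ?_
    rw [scaledLifetime, htop, ENNReal.mul_top (by simpa using ha₁), top_add, top_le_iff] at hω
    exact ENNReal.ofReal_ne_top hω
  simp only [← h.measureReal_shockEvent_inter ha₁ ha₂ hz₁ hz₂]
  have hnull := nullMeasurableSet_shockEvent h.joint
  have hdisj : Pairwise (Function.onFun Disjoint fun k => shockEvent J k) := by
    intro k k' hkk'
    refine Set.disjoint_left.2 fun ω h1 h2 => hkk' ?_
    exact Sum.inr_injective (h1.2.symm.trans h2.2)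
  set D := {ω | scaledLifetime J Y₁ a₁ ω ≤ ENNReal.ofReal z₁ ∧
    scaledLifetime J Y₂ a₂ ω ≤ ENNReal.ofReal z₂}
  -- D is not known to be measurable here, so additivity is obtained from the null-measurable shock
  -- events by restricting the measure.
  have h1 : P D = ∑ k, P (D ∩ shockEvent J k) := by
    calc P D = P.restrict (⋃ k, shockEvent J k) D := by
          rw [Measure.restrict_apply₀' (NullMeasurableSet.iUnion hnull),
            Set.inter_eq_left.2 hcover]
      _ = _ := by
          rw [Measure.restrict_iUnion_ae (hdisj.mono fun _ _ => Disjoint.aedisjoint) hnull,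
            Measure.sum_fintype, Measure.finsetSum_apply]
          exact Finset.sum_congr rfl fun k _ => Measure.restrict_apply₀' (hnull k)
  rw [measureReal_def, h1, ENNReal.toReal_sum fun k _ => measure_ne_top _ _]
  rfl

/-- The exponents add up: a(u - t) + (z - a u) = z - a t. This is why the vector Sᵢ carries the
leftover time zᵢ - aᵢ u. -/
theorem exp_mulVec_survivalVec (Q : Matrix S S ℝ) (a z u t : ℝ) :
    NormedSpace.exp ((u - t) • (a • Q)) *ᵥ survivalVec Q a z u =
      NormedSpace.exp ((z - a * t) • Q) *ᵥ 1 := by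
  rw [survivalVec, Matrix.mulVec_mulVec, smul_smul, ← Matrix.exp_add_of_commute, ← add_smul]
  · congr 3
    ring
  · exact ((Commute.refl Q).smul_left _).smul_right _

theorem dotProduct_vanLoan_shockMatrix (C₁ C₂ : Matrix S S ℝ) (v₁ v₂ : S → ℝ) (u : ℝ) :
    α ⬝ᵥ (vanLoan T (shockMatrix U) (kronSum C₁ C₂) u *ᵥ kronVec v₁ v₂) =
      ∑ k, ∫ t in (0 : ℝ)..u, shockDensity α T U k t *
        ((NormedSpace.exp ((u - t) • C₁) *ᵥ v₁) k * (NormedSpace.exp ((u - t) • C₂) *ᵥ v₂) k) := by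
  rw [dotProduct_vanLoan_mulVec, ← intervalIntegral.integral_finsetSum]
  · refine intervalIntegral.integral_congr fun t _ => ?_
    simp only [exp_smul_kronSum_mulVec_kronVec, shockMatrix_mulVec, dotProduct_exp_mulVec_mulVec]
    rfl
  · intro k _
    have hc : ∀ (C : Matrix S S ℝ) (v : S → ℝ),
        Continuous fun t : ℝ => (NormedSpace.exp ((u - t) • C) *ᵥ v) k := fun C v =>
      (continuous_apply k).comp ((((continuous_exp_smul C).comp
        (continuous_const.sub continuous_id))).matrix_mulVec continuous_const)
    exact ((continuous_shockDensity α T U k).mul ((hc C₁ v₁).mul (hc C₂ v₂))).intervalIntegrable _ _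

end Main

end CSPH

theorem mainTheorem2 {E : Type v₁} {S : Type v₂} [Fintype E] [Fintype S]
    [DecidableEq E] [DecidableEq S] {Ω : Type v₃} [MeasurableSpace Ω] (μ : Measure Ω)
    [IsProbabilityMeasure μ]
    (α : E → ℝ) (T : Matrix E E ℝ) (U : Matrix E S ℝ) (Q₁ Q₂ : Matrix S S ℝ) (a₁ a₂ : ℝ)
    (X₁ X₂ : Ω → ℝ≥0∞)
    (hX : IsCSPH.{v₁, v₂, v₃, v₄} μ X₁ X₂ α T U Q₁ Q₂ a₁ a₂)
    (z₁ z₂ : ℝ) (hz₁ : 0 ≤ z₁) (hz₂ : 0 ≤ z₂) :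
    μ.real {ω | X₁ ω ≤ ENNReal.ofReal z₁ ∧ X₂ ω ≤ ENNReal.ofReal z₂} =
      α ⬝ᵥ (vanLoan T (shockMatrix U) (kronSum (0 : Matrix S S ℝ) (0 : Matrix S S ℝ))
          (scaledMin a₁ a₂ z₁ z₂) *ᵥ
          kronVec 1 1)
        - α ⬝ᵥ (vanLoan T (shockMatrix U) (kronSum (a₁ • Q₁) (0 : Matrix S S ℝ))
          (scaledMin a₁ a₂ z₁ z₂) *ᵥ
          kronVec (survivalVec Q₁ a₁ z₁ (scaledMin a₁ a₂ z₁ z₂)) 1)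
        - α ⬝ᵥ (vanLoan T (shockMatrix U) (kronSum (0 : Matrix S S ℝ) (a₂ • Q₂))
          (scaledMin a₁ a₂ z₁ z₂) *ᵥ
          kronVec 1 (survivalVec Q₂ a₂ z₂ (scaledMin a₁ a₂ z₁ z₂)))
        + α ⬝ᵥ (vanLoan T (shockMatrix U) (kronSum (a₁ • Q₁) (a₂ • Q₂))
          (scaledMin a₁ a₂ z₁ z₂) *ᵥ
          kronVec (survivalVec Q₁ a₁ z₁ (scaledMin a₁ a₂ z₁ z₂))
            (survivalVec Q₂ a₂ z₂ (scaledMin a₁ a₂ z₁ z₂))) := by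
  obtain ⟨hparam, Ω', _, P, _, J, Y₁, Y₂, hJ, hid⟩ := hX
  have hmeas : MeasurableSet {p : ℝ≥0∞ × ℝ≥0∞ | p.1 ≤ ENNReal.ofReal z₁ ∧
      p.2 ≤ ENNReal.ofReal z₂} :=
    (measurableSet_le measurable_fst measurable_const).inter
      (measurableSet_le measurable_snd measurable_const)
  have h1 : μ.real {ω | X₁ ω ≤ ENNReal.ofReal z₁ ∧ X₂ ω ≤ ENNReal.ofReal z₂} =
      P.real {ω | scaledLifetime J Y₁ a₁ ω ≤ ENNReal.ofReal z₁ ∧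
        scaledLifetime J Y₂ a₂ ω ≤ ENNReal.ofReal z₂} :=
    congrArg ENNReal.toReal (hid.measure_mem_eq hmeas)
  rw [h1, hJ.measureReal_scaledLifetime_le hparam.a₁_pos hparam.a₂_pos hz₁ hz₂]
  set u := scaledMin a₁ a₂ z₁ z₂
  -- The zero blocks have identity exponentials, so their factors become 1 and the four terms match
  -- the expanded product.
  simp only [dotProduct_vanLoan_shockMatrix, exp_mulVec_survivalVec, smul_zero,
    NormedSpace.exp_zero, Matrix.one_mulVec, Pi.one_apply, mul_one, one_mul]
  rw [← Finset.sum_sub_distrib, ← Finset.sum_sub_distrib, ← Finset.sum_add_distrib]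
  refine Finset.sum_congr rfl fun k _ => ?_
  have hf := continuous_shockDensity α T U k
  have hc : ∀ (Q : Matrix S S ℝ) (a z : ℝ),
      Continuous fun t : ℝ => (NormedSpace.exp ((z - a * t) • Q) *ᵥ 1) k := fun Q a z =>
    (continuous_apply k).comp ((((continuous_exp_smul Q).comp
      (continuous_const.sub (continuous_const.mul continuous_id)))).matrix_mulVec continuous_const)
  exact integral_mul_one_sub_mul_one_sub hf (hc Q₁ a₁ z₁) (hc Q₂ a₂ z₂) 0 u
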